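/- Let $X$ be a real Banach space with modulus of convexity $\delta_X(\epsilon)=\inf\{1-\|x+y\|/2 : \|x\|=\|y\|=1,\ \|x-y\|=\epsilon\}$ for $0\le\epsilon\le 2$ (so $\delta_X(0)=0$ if $X\ne\{0\}$, and $\inf\emptyset=\infty$) and modulus of smoothness $\rho_X(\tau)=\sup\{(\|x+y\|+\|x-y\|)/2-1 : \|x\|=1,\ \|y\|=\tau\}$ for $\tau>0$. Assume that $X$ is uniformly convex and uniformly smooth, both of power type $2$: there is a $K>0$ with $\delta_X(\epsilon)\ge K\epsilon^2$ for all $0<\epsilon\le 2$, and a $K'>0$ with $\rho_X(\tau)\le K'\tau^2$ for all $\tau>0$. Let $\Omega=X\setminus\{0\}$ and let $d(x)=d(x,\partial\Omega)$. For a rectifiable path $\gamma$ in $\Omega$ let $\ell_{\|\cdot\|}(\gamma)$ be its length with respect to the norm, let $\|d\gamma\|$ denote integration with respect to arc length along $\gamma$, and let $\ell_k(\gamma)=\int\frac{\|d\gamma\|}{d(\gamma)}$ be its quasihyperbolic length. Then there exists $R>0$ with the following property. Let $0\le t_1\le t_2$ and let $\gamma_1,\gamma_2\colon[0,t_2]\to\Omega$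 be rectifiable paths such that 1. $1\le\|z\|<2$ for every point $z$ of the paths $\gamma_1$, $\gamma_2$ and $(\gamma_1+\gamma_2)/2$; 2. $\gamma_1(0)=\gamma_2(0)$; 3. $\max(\ell_k(\gamma_1),\ell_k(\gamma_2))\le R$; 4. $\ell_{\|\cdot\|}(\gamma_1)=t_1\le t_2=\ell_{\|\cdot\|}(\gamma_2)$; 5. $\gamma_2$ is parametrised by arc length on $[0,t_2]$, and $\gamma_1$ is parametrised by arc length on $[0,t_1]$, with $\gamma_1(t)=\gamma_1(t_1)$ for $t\in[t_1,t_2]$. Then the derivative $D(\gamma_1-\gamma_2)(s)$ exists for almost every $s\in[0,t_1]$, and $$\frac{\ell_k(\gamma_1)+\ell_k(\gamma_2)}{2}+\int_{t_1}^{t_2}\frac{\|d\gamma_2\|}{2d(\gamma_2)}\ \ge\ \ell_k\!\left(\frac{\gamma_1+\gamma_2}{2}\right) +\int_0^{t_1}\frac{\delta_X(\|D(\gamma_1-\gamma_2)(s)\|)}{\|\gamma_1(s)\|+\|\gamma_2(s)\|}\,ds .$$ -/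

import Mathlib

open Set MeasureTheory
open scoped ENNReal

/-- The modulus of convexity
`δ_X(ε) = inf {1 - ‖x + y‖ / 2 : ‖x‖ = ‖y‖ = 1, ‖x - y‖ = ε}`. The numbers over which the infimum
is taken are nonnegative; it is taken in `[0, ∞]`, so that an infimum over the empty set
(which occurs for `0 < ε < 2` in dimension one) is `∞`. -/
noncomputable def modulusOfConvexity (X : Type*) [NormedAddCommGroup X] [NormedSpace ℝ X]
    (ε : ℝ) : ℝ≥0∞ :=
  ⨅ (x : X) (y : X) (_ : ‖x‖ = 1 ∧ ‖y‖ = 1 ∧ ‖x - y‖ = ε), ENNReal.ofReal (1 - ‖x + y‖ / 2)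

/-- The modulus of smoothness
`ρ_X(τ) = sup {(‖x + y‖ + ‖x - y‖) / 2 - 1 : ‖x‖ = 1, ‖y‖ = τ}`. The numbers over which the
supremum is taken are nonnegative. -/
noncomputable def modulusOfSmoothness (X : Type*) [NormedAddCommGroup X] [NormedSpace ℝ X]
    (τ : ℝ) : ℝ≥0∞ :=
  ⨆ (x : X) (y : X) (_ : ‖x‖ = 1 ∧ ‖y‖ = τ), ENNReal.ofReal ((‖x + y‖ + ‖x - y‖) / 2 - 1)

/-- `X` is uniformly convex of power type `p`: `δ_X(ε) ≥ K ε ^ p` for `0 < ε ≤ 2`, for some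
constant `K > 0`. -/
def UniformlyConvexOfPowerType (X : Type*) [NormedAddCommGroup X] [NormedSpace ℝ X]
    (p : ℝ) : Prop :=
  ∃ K : ℝ, 0 < K ∧ ∀ ε : ℝ, 0 < ε → ε ≤ 2 → ENNReal.ofReal (K * ε ^ p) ≤ modulusOfConvexity X ε

/-- `X` is uniformly smooth of power type `p`: `ρ_X(τ) ≤ K τ ^ p` for `τ > 0`, for some
constant `K > 0`. -/
def UniformlySmoothOfPowerType (X : Type*) [NormedAddCommGroup X] [NormedSpace ℝ X]
    (p : ℝ) : Prop :=
  ∃ K : ℝ, 0 < K ∧ ∀ τ : ℝ, 0 < τ → modulusOfSmoothness X τ ≤ ENNReal.ofReal (K * τ ^ p)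

/-- The integral `∫_γ w |dz|` with respect to arc length along the rectifiable path
`γ : [a, b] → X`: the integral of `w` over the arc-length reparametrisation of `γ`, which is
defined on `[0, L]` where `L` is the length (total variation) of `γ` on `[a, b]`. -/
noncomputable def arcLengthIntegral {X : Type*} [NormedAddCommGroup X] [NormedSpace ℝ X]
    (w : X → ℝ≥0∞) (γ : ℝ → X) (a b : ℝ) : ℝ≥0∞ :=
  ∫⁻ s in Icc 0 (eVariationOn γ (Icc a b)).toReal, w (naturalParameterization γ (Icc a b) a s)

/-- The distance `d(x) = d(x, ∂Ω)` from a point to the boundary of `Ω`. -/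
noncomputable def bdryDist {X : Type*} [NormedAddCommGroup X] [NormedSpace ℝ X]
    (Ω : Set X) (x : X) : ℝ≥0∞ :=
  Metric.infEDist x (frontier Ω)

/-- The quasihyperbolic length `ℓ_k(γ) = ∫_γ |dz| / d(z, ∂Ω)` of a rectifiable path
`γ : [a, b] → Ω`. -/
noncomputable def quasihyperbolicLength {X : Type*} [NormedAddCommGroup X] [NormedSpace ℝ X]
    (Ω : Set X) (γ : ℝ → X) (a b : ℝ) : ℝ≥0∞ :=
  arcLengthIntegral (fun z => (bdryDist Ω z)⁻¹) γ a b

section Auxiliary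

open scoped Interval Topology NNReal
open Filter

/-! Write u, v for the velocities of the two paths at time s ≤ t₁ and x, y for their positions. The
midpoint path has speed 1 - D with D = 1 - ‖u + v‖/2. Convexity makes D both at least δ(‖u - v‖) and
at least K‖u - v‖². Smoothness makes the norm of the midpoint fall short of (‖x‖ + ‖y‖)/2 by at most
C‖x - y‖², so passing to the midpoint raises the mean of the densities 1/‖x‖, 1/‖y‖ by at most that
much. The gain D/‖(x + y)/2‖ is at least 2D/(‖x‖ + ‖y‖): one half pays for the δ term, the other
leaves (K/4)‖u - v‖² (`midpoint_speed_le`).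

The paths share their starting point, so a Poincaré inequality on [0, t₁] gives ∫‖γ₁ - γ₂‖² ≤ t₁²
∫‖(γ₁ - γ₂)'‖². For small R the paths are short, C t₁² ≤ K/4, and the surplus absorbs the smoothness
error (`lintegral_midpoint_le`). On [t₁, t₂] the midpoint moves at speed 1/2 where the density is at
most 1, which is at most 1/‖γ₂‖.

Two analytic facts support this. Unit-speed curves in a uniformly convex Banach space are
differentiable almost everywhere with derivative of norm 1
(`LipschitzWith.ae_differentiableAt_of_eVariationOn`). The arc-length integral along the midpoint
path, which need not have unit speed, is bounded by the integral of density times speed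
(`arcLengthIntegral_le_lintegral_deriv`); only this inequality is needed. -/

theorem LipschitzWith.enorm_sub_le_lintegral_deriv {f : ℝ → ℝ} {C : ℝ≥0} (hf : LipschitzWith C f)
    (a b : ℝ) : ‖f b - f a‖ₑ ≤ ∫⁻ t in Ι a b, ‖deriv f t‖ₑ := by
  have hac : AbsolutelyContinuousOnInterval f a b :=
    (hf.lipschitzOnWith (s := uIcc a b)).absolutelyContinuousOnInterval
  rw [← hac.integral_deriv_eq_sub]
  have h : ‖∫ t in a..b, deriv f t‖ₑ = ‖∫ t in Ι a b, deriv f t‖ₑ := by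
    rw [← ofReal_norm, ← ofReal_norm, intervalIntegral.norm_integral_eq_norm_integral_uIoc]
  rw [h]
  exact enorm_integral_le_lintegral_enorm _

/-! ### Bounding total variation by integrals -/

section Variation

theorem sum_lintegral_Ioc_eq {m : ℝ → ℝ≥0∞} {u : ℕ → ℝ} (hu : Monotone u) (n : ℕ) :
    ∑ i ∈ Finset.range n, ∫⁻ t in Ioc (u i) (u (i + 1)), m t = ∫⁻ t in Ioc (u 0) (u n), m t := by
  induction n with
  | zero => simp
  | succ n ih =>
    rw [Finset.sum_range_succ, ih, ← lintegral_union measurableSet_Ioc,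
      Ioc_union_Ioc_eq_Ioc (hu (Nat.zero_le n)) (hu n.le_succ)]
    exact Ioc_disjoint_Ioc_of_le le_rfl

theorem eVariationOn_Icc_le_lintegral {E : Type*} [PseudoEMetricSpace E] {g : ℝ → E}
    {m : ℝ → ℝ≥0∞} {a b : ℝ}
    (h : ∀ x y, a ≤ x → x ≤ y → y ≤ b → edist (g x) (g y) ≤ ∫⁻ t in Ioc x y, m t) :
    eVariationOn g (Icc a b) ≤ ∫⁻ t in Ioc a b, m t := by
  refine iSup_le fun ⟨n, u, hu, hmem⟩ => ?_
  calc ∑ i ∈ Finset.range n, edist (g (u (i + 1))) (g (u i))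
      ≤ ∑ i ∈ Finset.range n, ∫⁻ t in Ioc (u i) (u (i + 1)), m t :=
        Finset.sum_le_sum fun i _ => by
          rw [edist_comm]
          exact h _ _ (hmem i).1 (hu i.le_succ) (hmem (i + 1)).2
    _ = ∫⁻ t in Ioc (u 0) (u n), m t := sum_lintegral_Ioc_eq hu n
    _ ≤ ∫⁻ t in Ioc a b, m t := lintegral_mono_set (Ioc_subset_Ioc (hmem 0).1 (hmem n).2)

end Variation

/-! ### Almost everywhere differentiability of unit-speed curves -/

section Differentiability

variable {X : Type*} [NormedAddCommGroup X] [NormedSpace ℝ X]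

theorem LipschitzWith.dual_comp {g : ℝ → X} {C : ℝ≥0} (hg : LipschitzWith C g)
    {φ : StrongDual ℝ X} (hφ : ‖φ‖ ≤ 1) : LipschitzWith C (fun t => φ (g t)) := by
  have h1 : LipschitzWith 1 φ := φ.lipschitz.weaken (by exact_mod_cast hφ)
  simpa [Function.comp_def] using h1.comp hg

/-- A Lipschitz curve which is differentiable almost everywhere moves by at most the integral of
the norm of its derivative. -/
theorem LipschitzWith.edist_le_lintegral_deriv {g : ℝ → X} {C : ℝ≥0} (hg : LipschitzWith C g)
    {a b : ℝ} (hab : a ≤ b) (hd : ∀ᵐ t ∂volume.restrict (Ioc a b), DifferentiableAt ℝ g t) :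
    edist (g a) (g b) ≤ ∫⁻ t in Ioc a b, ‖deriv g t‖ₑ := by
  obtain ⟨φ, hφ, hφg⟩ := exists_dual_vector'' ℝ (g b - g a)
  have h1 := (hg.dual_comp hφ).enorm_sub_le_lintegral_deriv a b
  rw [← map_sub, hφg, uIoc_of_le hab] at h1
  rw [edist_comm, edist_eq_enorm_sub]
  calc ‖g b - g a‖ₑ = ‖((‖g b - g a‖ : ℝ))‖ₑ := by simp
    _ ≤ _ := h1
    _ ≤ ∫⁻ t in Ioc a b, ‖deriv g t‖ₑ := by
      refine lintegral_mono_ae ?_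
      filter_upwards [hd] with t ht
      have : deriv (fun t => φ (g t)) t = φ (deriv g t) :=
        (φ.hasFDerivAt.comp_hasDerivAt t ht.hasDerivAt).deriv
      rw [this, ← ofReal_norm, ← ofReal_norm]
      exact ENNReal.ofReal_le_ofReal ((φ.le_opNorm _).trans
        (mul_le_of_le_one_left (norm_nonneg _) hφ))

/-- Countably many functionals norm all increments of a Lipschitz curve. -/
theorem LipschitzWith.exists_countable_norming {g : ℝ → X} {C : ℝ≥0} (hg : LipschitzWith C g) :
    ∃ φ : ℚ × ℚ → StrongDual ℝ X, (∀ n, ‖φ n‖ ≤ 1) ∧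
      ∀ x y, edist (g x) (g y) ≤ ⨆ n, ‖φ n (g y) - φ n (g x)‖ₑ := by
  -- The functionals norm the increments between rational times. Moving each endpoint to a nearby
  -- rational costs ε/4 in the norm and ε/4 under the functional, hence ε in all; the denominator C
  -- + 1 allows C = 0.
  choose φ hφ hφg using fun n : ℚ × ℚ => exists_dual_vector'' ℝ (g n.2 - g n.1)
  refine ⟨φ, hφ, fun x y => ?_⟩
  refine ENNReal.le_of_forall_pos_le_add fun ε hε _ => ?_
  have hεC : (0 : ℝ) < ε / (4 * (C + 1)) := by positivity
  obtain ⟨p, hp1, hp2⟩ := exists_rat_btwn (show x < x + ε / (4 * (C + 1)) by linarith)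
  obtain ⟨q, hq1, hq2⟩ := exists_rat_btwn (show y < y + ε / (4 * (C + 1)) by linarith)
  refine le_trans ?_ (add_le_add_left (le_iSup (fun n => ‖φ n (g y) - φ n (g x)‖ₑ) (p, q)) _)
  have hCe : C * (ε / (4 * (C + 1)) : ℝ) ≤ ε / 4 := by
    have : (C : ℝ) / (C + 1) ≤ 1 := by rw [div_le_one (by positivity)]; linarith
    calc C * (ε / (4 * (C + 1)) : ℝ) = (C / (C + 1)) * (ε / 4) := by field_simp
      _ ≤ 1 * (ε / 4) := by gcongr
      _ = ε / 4 := one_mul _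
  have hx : ‖g p - g x‖ ≤ ε / 4 := by
    refine (hg.norm_sub_le _ _).trans (le_trans ?_ hCe)
    gcongr
    rw [Real.norm_eq_abs, abs_of_pos (by linarith)]; linarith
  have hy : ‖g q - g y‖ ≤ ε / 4 := by
    refine (hg.norm_sub_le _ _).trans (le_trans ?_ hCe)
    gcongr
    rw [Real.norm_eq_abs, abs_of_pos (by linarith)]; linarith
  have hb : ∀ z, |φ (p, q) z| ≤ ‖z‖ := fun z =>
    ((φ (p, q)).le_opNorm z).trans (mul_le_of_le_one_left (norm_nonneg _) (hφ _))
  have h1 : φ (p, q) (g q) - φ (p, q) (g p) = ‖g q - g p‖ := by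
    rw [← map_sub]; exact hφg (p, q)
  have h2 := abs_le.1 (hb (g p - g x))
  have h3 := abs_le.1 (hb (g q - g y))
  rw [map_sub] at h2 h3
  have h4 : ‖g y - g x‖ ≤ ‖g q - g p‖ + ‖g p - g x‖ + ‖g q - g y‖ := by
    have : g y - g x = (g q - g p) + (g p - g x) - (g q - g y) := by abel
    rw [this]
    exact (_root_.norm_sub_le _ _).trans (by gcongr; exact norm_add_le _ _)
  have h5 : ‖g y - g x‖ ≤ |φ (p, q) (g y) - φ (p, q) (g x)| + ε := by
    have := le_abs_self (φ (p, q) (g y) - φ (p, q) (g x))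
    linarith [h2.1, h2.2, h3.1, h3.2]
  rw [edist_comm, edist_eq_enorm_sub, ← ofReal_norm, ← ofReal_norm, ← ENNReal.ofReal_coe_nnreal,
    Real.norm_eq_abs,
    ← ENNReal.ofReal_add (abs_nonneg _) ε.coe_nonneg]
  exact ENNReal.ofReal_le_ofReal h5

theorem slope_norm_le {g : ℝ → X} (hg : LipschitzWith 1 g) (s t : ℝ) : ‖slope g s t‖ ≤ 1 := by
  rw [slope_def_module, norm_smul, norm_inv]
  have := hg.norm_sub_le t s
  rw [NNReal.coe_one, one_mul] at this
  exact (mul_le_mul_of_nonneg_left this (by positivity)).trans (inv_mul_le_one)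

/-- In a uniformly convex space, the difference quotients of a `1`-Lipschitz curve converge at every
point at which their norming functionals see a speed arbitrarily close to `1`. -/
theorem LipschitzWith.differentiableAt_of_norming [CompleteSpace X] [UniformConvexSpace X]
    {g : ℝ → X} (hg : LipschitzWith 1 g) {s : ℝ}
    (h : ∀ η : ℝ, 0 < η → ∃ φ : StrongDual ℝ X, ‖φ‖ ≤ 1 ∧ DifferentiableAt ℝ (fun t => φ (g t)) s ∧
      1 - η < deriv (fun t => φ (g t)) s) :
    DifferentiableAt ℝ g s ∧ ‖deriv g s‖ = 1 := by
  have hslope : ∀ φ : StrongDual ℝ X, ∀ t, slope (fun t => φ (g t)) s t = φ (slope g s t) := by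
    intro φ t
    simp [slope_def_module]
  have hcau : Cauchy (map (slope g s) (𝓝[≠] s)) := by
    rw [Metric.cauchy_iff]
    refine ⟨inferInstance, fun ε hε => ?_⟩
    -- The slopes near s lie in the slice φ > 1 - δ/2 of the unit ball. Two points of it have a sum
    -- of norm above 2 - δ, so uniform convexity puts them within ε of each other.
    obtain ⟨δ, hδ, hconv⟩ := exists_forall_closed_ball_dist_add_le_two_sub X hε
    obtain ⟨φ, hφ, hd, hlt⟩ := h (δ / 2) (by positivity)
    have hev := (hasDerivAt_iff_tendsto_slope.1 hd.hasDerivAt).eventually (lt_mem_nhds hlt)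
    refine ⟨{x | ‖x‖ ≤ 1 ∧ 1 - δ / 2 < φ x}, ?_, fun x hx y hy => ?_⟩
    · rw [mem_map]
      filter_upwards [hev] with t ht
      exact ⟨slope_norm_le hg _ _, by rwa [hslope] at ht⟩
    · by_contra! hxy
      rw [dist_eq_norm] at hxy
      have h1 := hconv hx.1 hy.1 hxy
      have h2 : φ (x + y) ≤ ‖x + y‖ := (le_abs_self _).trans
        (((φ).le_opNorm _).trans (mul_le_of_le_one_left (norm_nonneg _) hφ))
      rw [map_add] at h2
      linarith [hx.2, hy.2]
  obtain ⟨v, hv⟩ := CompleteSpace.complete hcau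
  have hder : HasDerivAt g v s := hasDerivAt_iff_tendsto_slope.2 hv
  refine ⟨hder.differentiableAt, le_antisymm ?_ ?_⟩
  · rw [hder.deriv]
    have hv' : Tendsto (slope g s) (𝓝[≠] s) (𝓝 v) := hv
    exact le_of_tendsto hv'.norm (Eventually.of_forall fun t => slope_norm_le hg _ _)
  · refine le_of_forall_pos_lt_add fun η hη => ?_
    obtain ⟨φ, hφ, hd, hlt⟩ := h η hη
    have h1 : deriv (fun t => φ (g t)) s = φ v :=
      (φ.hasFDerivAt.comp_hasDerivAt s hder).deriv
    have h2 : φ v ≤ ‖v‖ := (le_abs_self _).trans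
        (((φ).le_opNorm _).trans (mul_le_of_le_one_left (norm_nonneg _) hφ))
    rw [hder.deriv]
    linarith

/-- Countably many functionals recover the variation, so the supremum m of their speeds along g has
integral at least b - a. Since m ≤ 1, it equals 1 almost everywhere, and there some functional sees
speed arbitrarily close to 1. -/
theorem LipschitzWith.ae_differentiableAt_of_eVariationOn [CompleteSpace X] [UniformConvexSpace X]
    {g : ℝ → X} (hg : LipschitzWith 1 g) {a b : ℝ}
    (hvar : eVariationOn g (Icc a b) = ENNReal.ofReal (b - a)) :
    ∀ᵐ s ∂volume.restrict (Ioc a b), DifferentiableAt ℝ g s ∧ ‖deriv g s‖ = 1 := by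
  obtain ⟨φ, hφ, hnorm⟩ := hg.exists_countable_norming
  set m : ℝ → ℝ≥0∞ := fun t => ⨆ n, ‖deriv (fun t => φ n (g t)) t‖ₑ with hm
  have hmeas : Measurable m := Measurable.iSup fun n => (measurable_deriv _).enorm
  have hm1 : ∀ t, m t ≤ 1 := by
    refine fun t => iSup_le fun n => ?_
    rw [← ofReal_norm, ← ENNReal.ofReal_one]
    refine ENNReal.ofReal_le_ofReal ?_
    simpa using norm_deriv_le_of_lipschitz (x₀ := t) (hg.dual_comp (hφ n))
  have hle : eVariationOn g (Icc a b) ≤ ∫⁻ t in Ioc a b, m t := by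
    refine eVariationOn_Icc_le_lintegral fun x y _ hxy _ => (hnorm x y).trans (iSup_le fun n => ?_)
    have := (hg.dual_comp (hφ n)).enorm_sub_le_lintegral_deriv x y
    rw [uIoc_of_le hxy] at this
    exact this.trans (lintegral_mono fun t => le_iSup (fun n => ‖deriv (fun t => φ n (g t)) t‖ₑ) n)
  have hm_eq : m =ᵐ[volume.restrict (Ioc a b)] fun _ => 1 := by
    refine ae_eq_of_ae_le_of_lintegral_le (Eventually.of_forall hm1) ?_ aemeasurable_const ?_
    · refine ne_top_of_le_ne_top ?_ (lintegral_mono hm1)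
      simp
    · rw [← hvar.symm.trans_le hle |>.antisymm ?_]
      · simp
      · exact (lintegral_mono hm1).trans_eq (by simp)
  have hdiff : ∀ᵐ s ∂volume.restrict (Ioc a b), ∀ n, DifferentiableAt ℝ (fun t => φ n (g t)) s :=
    ae_restrict_of_ae (ae_all_iff.2 fun n => (hg.dual_comp (hφ n)).ae_differentiableAt_real)
  filter_upwards [hm_eq, hdiff] with s hs hd
  refine hg.differentiableAt_of_norming fun η hη => ?_
  have hlt : ENNReal.ofReal (1 - η) < m s := by
    rw [hs, ENNReal.ofReal_lt_one]
    linarith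
  obtain ⟨n, hn⟩ := lt_iSup_iff.1 hlt
  rw [← ofReal_norm] at hn
  have hn' : 1 - η < |deriv (fun t => φ n (g t)) s| := (ENNReal.ofReal_lt_ofReal_iff').1 hn |>.1
  rcases lt_abs.1 hn' with h | h
  · exact ⟨φ n, hφ n, hd n, h⟩
  · refine ⟨-φ n, by simpa using hφ n, by simp [hd n], ?_⟩
    have : deriv (fun t => (-φ n) (g t)) s = -deriv (fun t => φ n (g t)) s := by simp
    rwa [this]

end Differentiability

/-! ### Arc length, and arc-length integrals in a general parametrisation -/

section ArcLength

variable {X : Type*} [NormedAddCommGroup X]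

theorem HasUnitSpeedOn.eVariationOn_Icc {γ : ℝ → X} {a b x y : ℝ}
    (h : HasUnitSpeedOn γ (Icc a b)) (hx : a ≤ x) (hxy : x ≤ y) (hy : y ≤ b) :
    eVariationOn γ (Icc x y) = ENNReal.ofReal (y - x) := by
  have := h (x := x) ⟨hx, hxy.trans hy⟩ (y := y) ⟨hx.trans hxy, hy⟩
  rwa [Icc_inter_Icc, max_eq_right hx, min_eq_right hy, NNReal.coe_one, one_mul] at this

theorem HasUnitSpeedOn.edist_le {γ : ℝ → X} {a b x y : ℝ}
    (h : HasUnitSpeedOn γ (Icc a b)) (hx : a ≤ x) (hxy : x ≤ y) (hy : y ≤ b) :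
    edist (γ x) (γ y) ≤ edist x y := by
  refine (eVariationOn.edist_le γ (left_mem_Icc.2 hxy) (right_mem_Icc.2 hxy)).trans_eq ?_
  rw [h.eVariationOn_Icc hx hxy hy, edist_comm, edist_dist, Real.dist_eq,
    abs_of_nonneg (by linarith)]

theorem HasUnitSpeedOn.lipschitzOnWith {γ : ℝ → X} {a b : ℝ}
    (h : HasUnitSpeedOn γ (Icc a b)) : LipschitzOnWith 1 γ (Icc a b) := by
  intro x hx y hy
  rw [ENNReal.coe_one, one_mul]
  rcases le_total x y with hxy | hxy
  · exact h.edist_le hx.1 hxy hy.2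
  · rw [edist_comm, edist_comm x]
    exact h.edist_le hy.1 hxy hx.2

theorem LipschitzOnWith.exists_lipschitzWith_eqOn_Icc {γ : ℝ → X} {C : ℝ≥0} {a b : ℝ} (hab : a ≤ b)
    (h : LipschitzOnWith C γ (Icc a b)) : ∃ g : ℝ → X, LipschitzWith C g ∧ EqOn γ g (Icc a b) :=
  ⟨IccExtend hab ((Icc a b).domRestrict γ), by
    simpa [IccExtend] using
      (lipschitzOnWith_iff_restrict.1 h).comp (LipschitzWith.projIcc hab),
    fun t ht => by simp [IccExtend_of_mem hab _ ht]⟩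

theorem Set.EqOn.eventuallyEq_nhds_of_mem_Ioo {E : Type*} {f g : ℝ → E} {a b t : ℝ}
    (h : EqOn f g (Icc a b)) (ht : t ∈ Ioo a b) : f =ᶠ[𝓝 t] g := by
  filter_upwards [Icc_mem_nhds ht.1 ht.2] with s hs using h hs

theorem LipschitzWith.locallyBoundedVariationOn' {γ : ℝ → X} {C : ℝ≥0} (hγ : LipschitzWith C γ)
    (s : Set ℝ) : LocallyBoundedVariationOn γ s :=
  (hγ.lipschitzOnWith (s := s)).locallyBoundedVariationOn

theorem LipschitzWith.eVariationOn_Icc_le {γ : ℝ → X} {C : ℝ≥0} (hγ : LipschitzWith C γ)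
    {x y : ℝ} (hxy : x ≤ y) : eVariationOn γ (Icc x y) ≤ ENNReal.ofReal (C * (y - x)) := by
  have h1 := (hγ.lipschitzOnWith (s := univ)).comp_eVariationOn_le
    (g := id) (mapsTo_univ _ (Icc x y))
  refine h1.trans ?_
  have h2 := (monotone_id (α := ℝ)).monotoneOn (Icc x y) |>.eVariationOn_eq
    (left_mem_Icc.2 hxy) (right_mem_Icc.2 hxy)
  rw [inter_self] at h2
  rw [ENNReal.ofReal_mul C.coe_nonneg, ENNReal.ofReal_coe_nnreal]
  gcongr
  exact h2.le

theorem variationOnFromTo_univ_sub {γ : ℝ → X} {C : ℝ≥0} (hγ : LipschitzWith C γ) (a : ℝ) {x y : ℝ}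
    (hxy : x ≤ y) : variationOnFromTo γ univ a y - variationOnFromTo γ univ a x =
      (eVariationOn γ (Icc x y)).toReal := by
  rw [variationOnFromTo.sub_right (hγ.locallyBoundedVariationOn' univ) (mem_univ _) (mem_univ _)
    (mem_univ _), variationOnFromTo.eq_of_le _ _ hxy, univ_inter]

theorem LipschitzWith.variationOnFromTo_univ {γ : ℝ → X} {C : ℝ≥0} (hγ : LipschitzWith C γ)
    (a : ℝ) : LipschitzWith C (variationOnFromTo γ univ a) := by
  refine LipschitzWith.of_le_add_mul C fun y x => ?_
  rcases le_total x y with hxy | hxy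
  · have h1 := variationOnFromTo_univ_sub hγ a hxy
    have h2 : (eVariationOn γ (Icc x y)).toReal ≤ C * (y - x) :=
      ENNReal.toReal_le_of_le_ofReal (mul_nonneg C.2 (by linarith)) (hγ.eVariationOn_Icc_le hxy)
    rw [Real.dist_eq, abs_of_nonneg (by linarith)]
    linarith
  · have h1 := variationOnFromTo_univ_sub hγ a hxy
    have h2 : 0 ≤ C * dist y x := by positivity
    linarith [ENNReal.toReal_nonneg (a := eVariationOn γ (Icc y x))]

theorem LipschitzWith.volume_image_eq_zero {f : ℝ → ℝ} {C : ℝ≥0} (hf : LipschitzWith C f)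
    {s : Set ℝ} (hs : volume s = 0) : volume (f '' s) = 0 := by
  have h := hf.hausdorffMeasure_image_le (d := 1) zero_le_one s
  rw [hausdorffMeasure_real, hs, mul_zero] at h
  exact le_antisymm h zero_le

theorem HasUnitSpeedOn.mono_Icc {γ : ℝ → X} {a b x y : ℝ} (h : HasUnitSpeedOn γ (Icc a b))
    (hx : a ≤ x) (hy : y ≤ b) : HasUnitSpeedOn γ (Icc x y) := by
  intro p hp q hq
  rw [← h (Icc_subset_Icc hx hy hp) (Icc_subset_Icc hx hy hq), Icc_inter_Icc, Icc_inter_Icc,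
    max_eq_right hp.1, min_eq_right hq.2, max_eq_right (hx.trans hp.1),
    min_eq_right (hq.2.trans hy)]

theorem LipschitzOnWith.of_eq_const_right {γ : ℝ → X} {C : ℝ≥0} {a b c : ℝ} (hab : a ≤ b)
    (h : LipschitzOnWith C γ (Icc a b)) (hc : ∀ t ∈ Icc b c, γ t = γ b) :
    LipschitzOnWith C γ (Icc a c) := by
  have hmin : ∀ t ∈ Icc a c, γ t = γ (min t b) := by
    intro t ht
    rcases le_total t b with htb | htb
    · rw [min_eq_left htb]
    · rw [min_eq_right htb, hc t ⟨htb, ht.2⟩]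
  intro x hx y hy
  rw [hmin x hx, hmin y hy]
  refine (h ⟨le_min hx.1 hab, min_le_right _ _⟩ ⟨le_min hy.1 hab, min_le_right _ _⟩).trans ?_
  gcongr
  simpa using (LipschitzWith.id.min_const b) x y

/-- The density is at least 1/2 in the ball of radius 2, so a bound on quasihyperbolic length bounds
the length of the time interval. -/
theorem le_two_mul_of_lintegral_inv_le {γ : ℝ → X} {T R : ℝ} (hR : 0 ≤ R)
    (hn : ∀ t ∈ Icc 0 T, ‖γ t‖ ≤ 2) (h : ∫⁻ t in Icc 0 T, ‖γ t‖ₑ⁻¹ ≤ ENNReal.ofReal R) :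
    T ≤ 2 * R := by
  have h1 : ∫⁻ _ in Icc 0 T, (2⁻¹ : ℝ≥0∞) ≤ ∫⁻ t in Icc 0 T, ‖γ t‖ₑ⁻¹ :=
    setLIntegral_mono' measurableSet_Icc fun t ht => by
      rw [ENNReal.inv_le_inv, ← ofReal_norm, ← ENNReal.ofReal_ofNat]
      exact ENNReal.ofReal_le_ofReal (hn t ht)
  have h2 := h1.trans h
  rw [lintegral_const, Measure.restrict_apply_univ, Real.volume_Icc, sub_zero,
    ← ENNReal.ofReal_ofNat, ← ENNReal.ofReal_inv_of_pos two_pos,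
    ← ENNReal.ofReal_mul (by positivity), ENNReal.ofReal_le_ofReal_iff hR] at h2
  linarith

theorem restrict_Ioo_eq_add {a b c : ℝ} (hab : a ≤ b) (hbc : b ≤ c) :
    (volume.restrict (Ioo a c) : Measure ℝ) =
      volume.restrict (Ioo a b) + volume.restrict (Ioo b c) := by
  simp_rw [restrict_Ioo_eq_restrict_Ioc]
  rw [← Ioc_union_Ioc_eq_Ioc hab hbc,
    Measure.restrict_union (Ioc_disjoint_Ioc_of_le le_rfl) measurableSet_Ioc]

variable [NormedSpace ℝ X]

theorem HasUnitSpeedOn.ae_differentiableAt [CompleteSpace X] [UniformConvexSpace X] {γ : ℝ → X}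
    {a b : ℝ} (h : HasUnitSpeedOn γ (Icc a b)) :
    ∀ᵐ s ∂volume.restrict (Ioo a b), DifferentiableAt ℝ γ s ∧ ‖deriv γ s‖ = 1 := by
  rcases lt_or_ge b a with hab | hab
  · simp [Ioo_eq_empty hab.not_gt]
  obtain ⟨g, hg, hγg⟩ := h.lipschitzOnWith.exists_lipschitzWith_eqOn_Icc hab
  have hvar : eVariationOn g (Icc a b) = ENNReal.ofReal (b - a) := by
    rw [← eVariationOn.congr hγg, h.eVariationOn_Icc le_rfl hab le_rfl]
  filter_upwards [ae_restrict_of_ae_restrict_of_subset Ioo_subset_Ioc_self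
    (hg.ae_differentiableAt_of_eVariationOn hvar), ae_restrict_mem measurableSet_Ioo] with s hs hmem
  have heq := hγg.eventuallyEq_nhds_of_mem_Ioo hmem
  rw [heq.deriv_eq, heq.differentiableAt_iff]
  exact hs

/-- The integral with respect to arc length along a path which has unit speed on `[a, c]` and does
not move afterwards. -/
theorem arcLengthIntegral_eq_of_hasUnitSpeedOn {w : X → ℝ≥0∞} {γ : ℝ → X} {a c b : ℝ} (hac : a ≤ c)
    (hcb : c ≤ b) (hs : HasUnitSpeedOn γ (Icc a c))
    (hvar : eVariationOn γ (Icc a b) = ENNReal.ofReal (c - a)) :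
    arcLengthIntegral w γ a b = ∫⁻ t in Icc a c, w (γ t) := by
  have hbv : LocallyBoundedVariationOn γ (Icc a b) :=
    BoundedVariationOn.locallyBoundedVariationOn (by simp [BoundedVariationOn, hvar])
  have hnp : ∀ t ∈ Icc a c, naturalParameterization γ (Icc a b) a (t - a) = γ t := by
    intro t ht
    have h1 := edist_naturalParameterization_eq_zero hbv (left_mem_Icc.2 (hac.trans hcb))
      (show t ∈ Icc a b from ⟨ht.1, ht.2.trans hcb⟩)
    have h2 : variationOnFromTo γ (Icc a b) a t = t - a := by
      rw [variationOnFromTo.eq_of_le _ _ ht.1, Icc_inter_Icc, max_self,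
        min_eq_right (ht.2.trans hcb), hs.eVariationOn_Icc le_rfl ht.1 ht.2,
        ENNReal.toReal_ofReal (by linarith [ht.1])]
    rw [h2] at h1
    exact edist_eq_zero.1 h1
  rw [arcLengthIntegral, hvar, ENNReal.toReal_ofReal (by linarith),
    ← (measurePreserving_sub_right volume a).setLIntegral_comp_preimage_emb
      (measurableEmbedding_subRight a)]
  have hpre : (fun x => x - a) ⁻¹' Icc 0 (c - a) = Icc a c := by simp
  rw [hpre]
  exact setLIntegral_congr_fun measurableSet_Icc fun t ht => by simp only [hnp t ht]

/-- The total variation of a Lipschitz, almost everywhere differentiable curve grows at most at the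
speed of the curve. -/
theorem LipschitzWith.ae_deriv_variationOnFromTo_le [CompleteSpace X] {γ : ℝ → X} {C : ℝ≥0} (hγ : LipschitzWith C γ)
    {a b : ℝ} (hd : ∀ᵐ t ∂volume.restrict (Ioc a b), DifferentiableAt ℝ γ t) :
    ∀ᵐ t ∂volume.restrict (Ioo a b), DifferentiableAt ℝ (variationOnFromTo γ univ a) t ∧
      deriv (variationOnFromTo γ univ a) t ≤ ‖deriv γ t‖ := by
  set V := variationOnFromTo γ univ a
  have hV : LipschitzWith C V := hγ.variationOnFromTo_univ a
  have hint : ∀ x y : ℝ, IntervalIntegrable (fun t => ‖deriv γ t‖) volume x y := fun x y =>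
    (intervalIntegrable_const (c := (C : ℝ))).mono_fun
      (stronglyMeasurable_deriv γ).norm.aestronglyMeasurable
      (Eventually.of_forall fun t => by
        simpa using norm_deriv_le_of_lipschitz (x₀ := t) hγ)
  -- Variation over a subinterval is at most the integral of the speed, so this difference
  -- increases; its derivative is therefore nonnegative wherever it exists.
  have hmono : MonotoneOn (fun t => (∫ r in a..t, ‖deriv γ r‖) - V t) (Icc a b) := by
    intro x hx y hy hxy
    have h1 : eVariationOn γ (Icc x y) ≤ ∫⁻ t in Ioc x y, ‖deriv γ t‖ₑ :=
      eVariationOn_Icc_le_lintegral fun p q hp hpq hq => hγ.edist_le_lintegral_deriv hpq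
        (ae_restrict_of_ae_restrict_of_subset
          (Ioc_subset_Ioc (hx.1.trans hp) (hq.trans hy.2)) hd)
    have h2 : (∫ r in x..y, ‖deriv γ r‖) = (∫⁻ t in Ioc x y, ‖deriv γ t‖ₑ).toReal := by
      rw [intervalIntegral.integral_of_le hxy, integral_norm_eq_lintegral_enorm
        (stronglyMeasurable_deriv γ).aestronglyMeasurable]
    have h3 : (∫⁻ t in Ioc x y, ‖deriv γ t‖ₑ) ≠ ⊤ := by
      have := ((hint x y).1).2
      simpa [HasFiniteIntegral, lt_top_iff_ne_top] using this
    have h4 := ENNReal.toReal_mono h3 h1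
    have h5 := variationOnFromTo_univ_sub hγ a hxy
    have h6 := intervalIntegral.integral_interval_sub_left (hint a y) (hint a x)
    show (∫ r in a..x, ‖deriv γ r‖) - V x ≤ (∫ r in a..y, ‖deriv γ r‖) - V y
    change V y - V x = _ at h5
    linarith
  have hG : ∀ᵐ t ∂volume.restrict (Ioo a b),
      t ∈ uIcc a b → ∀ c ∈ uIcc a b,
        HasDerivAt (fun x => ∫ r in c..x, ‖deriv γ r‖) ‖deriv γ t‖ t :=
    ae_restrict_of_ae (hint a b).ae_hasDerivAt_integral
  filter_upwards [hG, ae_restrict_mem measurableSet_Ioo,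
    ae_restrict_of_ae hV.ae_differentiableAt_real] with t ht hmem hVt
  have hG' := ht (Icc_subset_uIcc (Ioo_subset_Icc_self hmem)) a left_mem_uIcc
  refine ⟨hVt, ?_⟩
  have h1 := hmono.derivWithin_nonneg (x := t)
  rw [derivWithin_of_mem_nhds (Icc_mem_nhds hmem.1 hmem.2), (hG'.fun_sub hVt.hasDerivAt).deriv] at h1
  linarith

/-- Change of variables s = V(t), with V the variation function. V is Lipschitz, hence maps null
sets to null sets, so the points where V is differentiable with V' ≤ ‖γ'‖ still cover almost all
arc-length parameters. -/
theorem arcLengthIntegral_le_lintegral_deriv [CompleteSpace X] (w : X → ℝ≥0∞) {γ : ℝ → X} {C : ℝ≥0}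
    {a b : ℝ} (hab : a ≤ b) (hγ : LipschitzOnWith C γ (Icc a b))
    (hd : ∀ᵐ t ∂volume.restrict (Ioo a b), DifferentiableAt ℝ γ t) :
    arcLengthIntegral w γ a b ≤ ∫⁻ t in Ioo a b, ‖deriv γ t‖ₑ * w (γ t) := by
  obtain ⟨g, hg, hγg⟩ := hγ.exists_lipschitzWith_eqOn_Icc hab
  have hderiv : ∀ t ∈ Ioo a b, deriv γ t = deriv g t := fun t ht =>
    (hγg.eventuallyEq_nhds_of_mem_Ioo ht).deriv_eq
  have hdg : ∀ᵐ t ∂volume.restrict (Ioo a b), DifferentiableAt ℝ g t := by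
    filter_upwards [hd, ae_restrict_mem measurableSet_Ioo] with t ht hmem
    exact (hγg.eventuallyEq_nhds_of_mem_Ioo hmem).differentiableAt_iff.1 ht
  have hV := hg.variationOnFromTo_univ a
  have hbv := hγ.locallyBoundedVariationOn
  have hVd := hg.ae_deriv_variationOnFromTo_le (a := a) (b := b)
    (by rwa [← restrict_Ioo_eq_restrict_Ioc])
  have hVmono : Monotone (variationOnFromTo g univ a) := monotoneOn_univ.1
    (variationOnFromTo.monotoneOn (hg.locallyBoundedVariationOn' univ) (mem_univ a))
  have hVt : ∀ t ∈ Icc a b, variationOnFromTo g univ a t = variationOnFromTo γ (Icc a b) a t := by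
    intro t ht
    rw [variationOnFromTo.eq_of_le _ _ ht.1, variationOnFromTo.eq_of_le _ _ ht.1, univ_inter,
      Icc_inter_Icc, max_self, min_eq_right ht.2,
      eVariationOn.congr (hγg.mono (Icc_subset_Icc_right ht.2))]
  have hV0 : variationOnFromTo g univ a a = 0 := variationOnFromTo.self _ _ _
  have hVb : variationOnFromTo g univ a b = (eVariationOn γ (Icc a b)).toReal := by
    rw [variationOnFromTo.eq_of_le _ _ hab, univ_inter, eVariationOn.congr hγg]
  set V := variationOnFromTo g univ a
  -- The bad set is enlarged to a measurable null set because the change of variables needs a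
  -- measurable domain.
  set N := toMeasurable (volume.restrict (Ioo a b))
    {t | ¬ (DifferentiableAt ℝ V t ∧ deriv V t ≤ ‖deriv g t‖)} with hN
  have hN0 : volume.restrict (Ioo a b) N = 0 := by rw [hN, measure_toMeasurable]; exact hVd
  have hNm : MeasurableSet N := measurableSet_toMeasurable _ _
  set S := Ioo a b \ N with hS
  have hSm : MeasurableSet S := measurableSet_Ioo.diff hNm
  have hgood : ∀ t ∈ S, DifferentiableAt ℝ V t ∧ deriv V t ≤ ‖deriv g t‖ := by
    intro t ht
    by_contra hcon
    exact ht.2 (subset_toMeasurable _ _ hcon)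
  have hnull : volume (Icc a b \ S) = 0 := by
    have hsub : Icc a b \ S ⊆ {a, b} ∪ (N ∩ Ioo a b) := by
      intro t ht
      by_cases hto : t ∈ Ioo a b
      · right
        by_contra hcon
        exact ht.2 ⟨hto, fun h => hcon ⟨h, hto⟩⟩
      · left
        rcases ht.1.1.eq_or_lt with h | h
        · simp [h]
        · rcases ht.1.2.eq_or_lt with h' | h'
          · simp [h']
          · exact absurd ⟨h, h'⟩ hto
    refine measure_mono_null hsub (measure_union_null ?_ ?_)
    · exact (toFinite _).measure_zero _
    · rwa [Measure.restrict_apply hNm] at hN0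
  have hcover : Icc 0 (eVariationOn γ (Icc a b)).toReal ≤ᵐ[volume] V '' S := by
    have h1 : Icc 0 (eVariationOn γ (Icc a b)).toReal ⊆ V '' Icc a b := by
      rw [← hVb, ← hV0]
      exact intermediate_value_Icc hab hV.continuous.continuousOn
    rw [ae_le_set]
    refine measure_mono_null ?_ (hV.volume_image_eq_zero hnull)
    rintro y ⟨hy, hyS⟩
    obtain ⟨t, ht, rfl⟩ := h1 hy
    exact ⟨t, ⟨ht, fun htS => hyS ⟨t, htS, rfl⟩⟩, rfl⟩
  calc arcLengthIntegral w γ a b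
      ≤ ∫⁻ s in V '' S, w (naturalParameterization γ (Icc a b) a s) := lintegral_mono_set' hcover
    _ = ∫⁻ t in S, ENNReal.ofReal (deriv V t) *
          w (naturalParameterization γ (Icc a b) a (V t)) :=
        lintegral_image_eq_lintegral_deriv_mul_of_monotoneOn hSm
          (fun t ht => (hgood t ht).1.hasDerivAt.hasDerivWithinAt) (hVmono.monotoneOn S) _
    _ ≤ ∫⁻ t in S, ‖deriv γ t‖ₑ * w (γ t) := by
        refine setLIntegral_mono' hSm fun t ht => ?_
        have htI : t ∈ Icc a b := Ioo_subset_Icc_self ht.1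
        have h1 := edist_naturalParameterization_eq_zero hbv (left_mem_Icc.2 hab) htI
        rw [← hVt t htI] at h1
        rw [edist_eq_zero.1 h1, hderiv t ht.1, ← ofReal_norm]
        gcongr
        exact (hgood t ht).2
    _ ≤ ∫⁻ t in Ioo a b, ‖deriv γ t‖ₑ * w (γ t) := lintegral_mono_set sdiff_subset

end ArcLength

/-! ### Pointwise estimates from convexity and smoothness, and the Poincaré inequality -/

section Pointwise

variable {X : Type*} [NormedAddCommGroup X] [NormedSpace ℝ X]

theorem modulusOfConvexity_le {u v : X} (hu : ‖u‖ = 1) (hv : ‖v‖ = 1) :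
    modulusOfConvexity X ‖u - v‖ ≤ ENNReal.ofReal (1 - ‖u + v‖ / 2) :=
  iInf_le_of_le u (iInf_le_of_le v (iInf_le _ ⟨hu, hv, rfl⟩))

theorem UniformlyConvexOfPowerType.exists_sq_le (h : UniformlyConvexOfPowerType X 2) :
    ∃ K : ℝ, 0 < K ∧ ∀ u v : X, ‖u‖ = 1 → ‖v‖ = 1 → K * ‖u - v‖ ^ 2 ≤ 1 - ‖u + v‖ / 2 := by
  obtain ⟨K, hK, h⟩ := h
  refine ⟨K, hK, fun u v hu hv => ?_⟩
  -- The power-type bound concerns only ε > 0, so coincident vectors are treated separately.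
  rcases (norm_nonneg (u - v)).eq_or_lt with h0 | h0
  · have : ‖u + v‖ ≤ 2 := by
      have := norm_add_le u v
      rw [hu, hv] at this; linarith
    rw [← h0]
    linarith
  · have h2 : ‖u - v‖ ≤ 2 := by
      have := norm_sub_le u v
      rw [hu, hv] at this; linarith
    have h3 := (h ‖u - v‖ h0 h2).trans (modulusOfConvexity_le hu hv)
    rw [Real.rpow_two, ENNReal.ofReal_le_ofReal_iff'] at h3
    have : 0 < K * ‖u - v‖ ^ 2 := by positivity
    rcases h3 with h3 | h3 <;> linarith

theorem UniformlyConvexOfPowerType.uniformConvexSpace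
    (h : UniformlyConvexOfPowerType X 2) : UniformConvexSpace X := by
  obtain ⟨K, hK, h⟩ := h.exists_sq_le
  refine ⟨fun ε hε => ⟨2 * (K * ε ^ 2), by positivity, fun x hx y hy hxy => ?_⟩⟩
  have h4 := h x y hx hy
  have h5 : K * ε ^ 2 ≤ K * ‖x - y‖ ^ 2 := by gcongr
  linarith

/-- In a uniformly smooth space of power type `2`, the norm of the midpoint of two points is close to
the mean of their norms. -/
theorem UniformlySmoothOfPowerType.exists_midpoint_bound (h : UniformlySmoothOfPowerType X 2) :
    ∃ K : ℝ, 0 < K ∧ ∀ x y : X, 1 ≤ ‖(2⁻¹ : ℝ) • (x + y)‖ →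
      (‖x‖ + ‖y‖) / 2 ≤ ‖(2⁻¹ : ℝ) • (x + y)‖ + K * ‖x - y‖ ^ 2 := by
  obtain ⟨K, hK, h⟩ := h
  refine ⟨K, hK, fun x y hm => ?_⟩
  set m := (2⁻¹ : ℝ) • (x + y) with hm_def
  set v := (2⁻¹ : ℝ) • (x - y) with hv_def
  have hx : x = m + v := by rw [hm_def, hv_def]; module
  have hy : y = m - v := by rw [hm_def, hv_def]; module
  have hvn : ‖v‖ = ‖x - y‖ / 2 := by
    rw [hv_def, norm_smul, norm_inv, Real.norm_two]; ring
  clear_value m v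
  have hm0 : 0 < ‖m‖ := by linarith
  rcases (norm_nonneg v).eq_or_lt with h0 | h0
  · have hv0 : v = 0 := norm_eq_zero.1 h0.symm
    rw [hx, hy, hv0]
    simp
  have h1 : ‖‖m‖⁻¹ • m‖ = 1 := by
    rw [norm_smul, norm_inv, norm_norm, inv_mul_cancel₀ hm0.ne']
  have h2 : ‖‖m‖⁻¹ • v‖ = ‖m‖⁻¹ * ‖v‖ := by rw [norm_smul, norm_inv, norm_norm]
  -- The modulus of smoothness is applied after scaling the midpoint m to norm 1. Scaling back
  -- leaves a factor ‖m‖⁻¹ in the error, which ‖m‖ ≥ 1 allows one to drop.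
  have h3 := (le_iSup_of_le (‖m‖⁻¹ • m) (le_iSup_of_le (‖m‖⁻¹ • v) (le_iSup_of_le ⟨h1, h2⟩ le_rfl)) :
    ENNReal.ofReal ((‖‖m‖⁻¹ • m + ‖m‖⁻¹ • v‖ + ‖‖m‖⁻¹ • m - ‖m‖⁻¹ • v‖) / 2 - 1) ≤
      modulusOfSmoothness X (‖m‖⁻¹ * ‖v‖)).trans (h _ (by positivity))
  rw [← smul_add, ← smul_sub, ← hx, ← hy, norm_smul, norm_smul, norm_inv, norm_norm,
    Real.rpow_two, ENNReal.ofReal_le_ofReal_iff (by positivity)] at h3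
  have h4 : ‖m‖ * ((‖m‖⁻¹ * ‖x‖ + ‖m‖⁻¹ * ‖y‖) / 2 - 1) ≤ ‖m‖ * (K * (‖m‖⁻¹ * ‖v‖) ^ 2) := by gcongr
  have h5 : ‖m‖ * ((‖m‖⁻¹ * ‖x‖ + ‖m‖⁻¹ * ‖y‖) / 2 - 1) = (‖x‖ + ‖y‖) / 2 - ‖m‖ := by field_simp
  have h6 : ‖m‖ * (K * (‖m‖⁻¹ * ‖v‖) ^ 2) = ‖m‖⁻¹ * (K * ‖v‖ ^ 2) := by field_simp
  have h7 : ‖m‖⁻¹ * (K * ‖v‖ ^ 2) ≤ K * ‖v‖ ^ 2 :=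
    mul_le_of_le_one_left (by positivity) (inv_le_one_of_one_le₀ hm)
  have h8 : K * ‖v‖ ^ 2 ≤ K * ‖x - y‖ ^ 2 := by
    have := norm_nonneg (x - y)
    gcongr
    linarith
  linarith

/-- Inversion is 1-Lipschitz on [1, ∞), which compares m with the mean of a and b; convexity of
inversion then compares the inverse of the mean with the mean of the inverses. -/
theorem inv_le_of_midpoint_bound {a b m e : ℝ} (ha : 1 ≤ a) (hb : 1 ≤ b) (hm : 1 ≤ m)
    (hme : m ≤ (a + b) / 2) (h : (a + b) / 2 ≤ m + e) : m⁻¹ ≤ (a⁻¹ + b⁻¹) / 2 + e := by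
  have h1 : m⁻¹ - ((a + b) / 2)⁻¹ ≤ e := by
    rw [inv_sub_inv (by positivity) (by positivity), div_le_iff₀ (by positivity)]
    have : 1 ≤ m * ((a + b) / 2) := one_le_mul_of_one_le_of_one_le hm (by linarith)
    nlinarith
  have h2 : ((a + b) / 2)⁻¹ ≤ (a⁻¹ + b⁻¹) / 2 := by
    have : (a⁻¹ + b⁻¹) / 2 - ((a + b) / 2)⁻¹ = (a - b) ^ 2 / (2 * a * b * (a + b)) := by
      field_simp
      ring
    have h3 : 0 ≤ (a - b) ^ 2 / (2 * a * b * (a + b)) := by positivity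
    linarith
  linarith

theorem midpoint_speed_le {K C : ℝ} (hK0 : 0 ≤ K) (hC0 : 0 ≤ C)
    (hK : ∀ u v : X, ‖u‖ = 1 → ‖v‖ = 1 → K * ‖u - v‖ ^ 2 ≤ 1 - ‖u + v‖ / 2)
    (hC : ∀ x y : X, 1 ≤ ‖(2⁻¹ : ℝ) • (x + y)‖ →
      (‖x‖ + ‖y‖) / 2 ≤ ‖(2⁻¹ : ℝ) • (x + y)‖ + C * ‖x - y‖ ^ 2)
    {x y u v : X} (hx : 1 ≤ ‖x‖) (hx2 : ‖x‖ ≤ 2) (hy : 1 ≤ ‖y‖) (hy2 : ‖y‖ ≤ 2)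
    (hm : 1 ≤ ‖(2⁻¹ : ℝ) • (x + y)‖) (hu : ‖u‖ = 1) (hv : ‖v‖ = 1) :
    ‖(2⁻¹ : ℝ) • (u + v)‖ₑ * ‖(2⁻¹ : ℝ) • (x + y)‖ₑ⁻¹ +
      modulusOfConvexity X ‖u - v‖ / ENNReal.ofReal (‖x‖ + ‖y‖) +
      ENNReal.ofReal (K / 4) * ‖u - v‖ₑ ^ 2 ≤
    (‖x‖ₑ⁻¹ + ‖y‖ₑ⁻¹) / 2 + ENNReal.ofReal C * ‖x - y‖ₑ ^ 2 := by
  have hnorm : ∀ z w : X, ‖(2⁻¹ : ℝ) • (z + w)‖ = ‖z + w‖ / 2 := fun z w => by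
    rw [norm_smul, norm_inv, Real.norm_two]; ring
  have hme : ‖(2⁻¹ : ℝ) • (x + y)‖ ≤ (‖x‖ + ‖y‖) / 2 := by
    rw [hnorm]; have := norm_add_le x y; linarith
  have hinv := inv_le_of_midpoint_bound hx hy hm hme (hC x y hm)
  have hKuv := hK u v hu hv
  set D := 1 - ‖u + v‖ / 2 with hD
  have hD0 : 0 ≤ D := le_trans (by positivity) hKuv
  have hw : ‖(2⁻¹ : ℝ) • (u + v)‖ = 1 - D := by rw [hnorm, hD]; ring
  have hδ : modulusOfConvexity X ‖u - v‖ / ENNReal.ofReal (‖x‖ + ‖y‖) ≤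
      ENNReal.ofReal (D / (‖x‖ + ‖y‖)) := by
    rw [ENNReal.ofReal_div_of_pos (by linarith)]
    exact ENNReal.div_le_div_right (modulusOfConvexity_le hu hv) _
  set m := ‖(2⁻¹ : ℝ) • (x + y)‖ with hm_def
  have hreal : (1 - D) * m⁻¹ + D / (‖x‖ + ‖y‖) + K / 4 * ‖u - v‖ ^ 2 ≤
      (‖x‖⁻¹ + ‖y‖⁻¹) / 2 + C * ‖x - y‖ ^ 2 := by
    -- First half of the gain: ‖x‖ + ‖y‖ ≤ 4 is the source of the constant 1/4.
    have h1 : K / 4 * ‖u - v‖ ^ 2 ≤ D / (‖x‖ + ‖y‖) := by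
      rw [le_div_iff₀ (by linarith)]
      have : K / 4 * ‖u - v‖ ^ 2 * (‖x‖ + ‖y‖) ≤ K / 4 * ‖u - v‖ ^ 2 * 4 := by
        gcongr; linarith
      linarith
    have h2 : 2 * (D / (‖x‖ + ‖y‖)) ≤ D * m⁻¹ := by
      have : 2 * (D / (‖x‖ + ‖y‖)) = D * ((‖x‖ + ‖y‖) / 2)⁻¹ := by field_simp
      rw [this]
      gcongr
    linarith
  have h1D : 0 ≤ 1 - D := by rw [← hw]; positivity
  have hx0 : 0 < ‖x‖ := by linarith
  have hy0 : 0 < ‖y‖ := by linarith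
  have hm0 : 0 < m := by linarith
  have hDxy : 0 ≤ D / (‖x‖ + ‖y‖) := by positivity
  calc _ ≤ ENNReal.ofReal (1 - D) * ENNReal.ofReal m⁻¹ + ENNReal.ofReal (D / (‖x‖ + ‖y‖)) +
        ENNReal.ofReal (K / 4) * ENNReal.ofReal (‖u - v‖ ^ 2) := by
        gcongr
        · rw [← ofReal_norm, hw]
        · rw [← ofReal_norm, ENNReal.ofReal_inv_of_pos hm0]
        · rw [← ofReal_norm, ENNReal.ofReal_pow (norm_nonneg _)]
    _ = ENNReal.ofReal ((1 - D) * m⁻¹ + D / (‖x‖ + ‖y‖) + K / 4 * ‖u - v‖ ^ 2) := by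
        rw [← ENNReal.ofReal_mul h1D, ← ENNReal.ofReal_mul (by positivity),
          ← ENNReal.ofReal_add (by positivity) hDxy,
          ← ENNReal.ofReal_add (by positivity) (by positivity)]
    _ ≤ ENNReal.ofReal ((‖x‖⁻¹ + ‖y‖⁻¹) / 2 + C * ‖x - y‖ ^ 2) := ENNReal.ofReal_le_ofReal hreal
    _ = _ := by
        rw [ENNReal.ofReal_add (by positivity) (by positivity), ENNReal.ofReal_mul hC0,
          ENNReal.ofReal_pow (norm_nonneg _), ENNReal.ofReal_div_of_pos two_pos,
          ENNReal.ofReal_add (by positivity) (by positivity), ENNReal.ofReal_inv_of_pos hx0,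
          ENNReal.ofReal_inv_of_pos hy0, ofReal_norm, ofReal_norm, ofReal_norm, ENNReal.ofReal_ofNat]

/-- A one-dimensional Poincaré inequality for a curve starting at the origin. -/
theorem LipschitzWith.lintegral_enorm_sq_le {h : ℝ → X} {C : ℝ≥0} [CompleteSpace X]
    (hh : LipschitzWith C h) {T : ℝ} (h0 : h 0 = 0)
    (hd : ∀ᵐ t ∂volume.restrict (Ioo 0 T), DifferentiableAt ℝ h t) :
    ∫⁻ s in Ioo 0 T, ‖h s‖ₑ ^ 2 ≤
      ENNReal.ofReal T ^ 2 * ∫⁻ s in Ioo 0 T, ‖deriv h s‖ₑ ^ 2 := by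
  have hpt : ∀ s ∈ Ioo 0 T,
      ‖h s‖ₑ ^ 2 ≤ ENNReal.ofReal T * ∫⁻ s in Ioo 0 T, ‖deriv h s‖ₑ ^ 2 := by
    intro s hs
    have h1 : ‖h s‖ₑ ≤ ∫⁻ t in Ioo 0 T, ‖deriv h t‖ₑ := by
      have := hh.edist_le_lintegral_deriv hs.1.le
        (ae_restrict_of_ae_restrict_of_subset (Ioc_subset_Ioo_right hs.2) hd)
      rw [h0, edist_zero_left] at this
      exact this.trans (lintegral_mono_set (Ioc_subset_Ioo_right hs.2))
    -- Cauchy–Schwarz against the constant 1 bounds h(s)² uniformly in s by T times the energy;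
    -- integrating over s supplies the second factor T.
    have h2 := ENNReal.lintegral_mul_le_Lp_mul_Lq (volume.restrict (Ioo 0 T))
      Real.HolderConjugate.two_two (f := fun t => ‖deriv h t‖ₑ) (g := fun _ => 1)
      (stronglyMeasurable_deriv h).enorm.aemeasurable aemeasurable_const
    simp only [Pi.mul_apply, mul_one, one_pow, lintegral_const, one_mul,
      Measure.restrict_apply_univ, Real.volume_Ioo, sub_zero, ENNReal.rpow_two] at h2
    calc ‖h s‖ₑ ^ 2 ≤ ((∫⁻ t in Ioo 0 T, ‖deriv h t‖ₑ ^ 2) ^ (1 / 2 : ℝ) *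
          ENNReal.ofReal T ^ (1 / 2 : ℝ)) ^ 2 := by gcongr; exact h1.trans h2
      _ = _ := by
        rw [mul_pow, ← ENNReal.rpow_two, ← ENNReal.rpow_two, ← ENNReal.rpow_mul,
          ← ENNReal.rpow_mul]
        norm_num [mul_comm]
  calc ∫⁻ s in Ioo 0 T, ‖h s‖ₑ ^ 2
      ≤ ∫⁻ _ in Ioo 0 T, ENNReal.ofReal T * ∫⁻ s in Ioo 0 T, ‖deriv h s‖ₑ ^ 2 :=
        setLIntegral_mono' measurableSet_Ioo hpt
    _ = _ := by
        rw [lintegral_const, Measure.restrict_apply_univ, Real.volume_Ioo, sub_zero]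
        ring

theorem LipschitzOnWith.lintegral_enorm_sq_le {h : ℝ → X} {C : ℝ≥0} [CompleteSpace X] {T : ℝ}
    (hT : 0 ≤ T) (hh : LipschitzOnWith C h (Icc 0 T)) (h0 : h 0 = 0)
    (hd : ∀ᵐ t ∂volume.restrict (Ioo 0 T), DifferentiableAt ℝ h t) :
    ∫⁻ s in Ioo 0 T, ‖h s‖ₑ ^ 2 ≤
      ENNReal.ofReal T ^ 2 * ∫⁻ s in Ioo 0 T, ‖deriv h s‖ₑ ^ 2 := by
  obtain ⟨g, hg, hhg⟩ := hh.exists_lipschitzWith_eqOn_Icc hT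
  have h1 := hg.lintegral_enorm_sq_le (T := T) (by rw [← hhg (left_mem_Icc.2 hT), h0]) (by
    filter_upwards [hd, ae_restrict_mem measurableSet_Ioo] with t ht hmem
    exact (hhg.eventuallyEq_nhds_of_mem_Ioo hmem).differentiableAt_iff.1 ht)
  have e1 : ∫⁻ s in Ioo 0 T, ‖h s‖ₑ ^ 2 = ∫⁻ s in Ioo 0 T, ‖g s‖ₑ ^ 2 :=
    setLIntegral_congr_fun measurableSet_Ioo fun t ht => by
      simp only [hhg (Ioo_subset_Icc_self ht)]
  have e2 : ∫⁻ s in Ioo 0 T, ‖deriv h s‖ₑ ^ 2 = ∫⁻ s in Ioo 0 T, ‖deriv g s‖ₑ ^ 2 :=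
    setLIntegral_congr_fun measurableSet_Ioo fun t ht => by
      simp only [(hhg.eventuallyEq_nhds_of_mem_Ioo ht).deriv_eq]
  rw [e1, e2]
  exact h1

/-- In a nontrivial space {0} has empty interior, so the boundary of its complement is {0}. -/
theorem bdryDist_compl_singleton_zero [Nontrivial X] (x : X) : bdryDist ({0}ᶜ : Set X) x = ‖x‖ₑ := by
  have : (𝓝[≠] (0 : X)).NeBot := Module.punctured_nhds_neBot ℝ X 0
  rw [bdryDist, frontier_compl, isClosed_singleton.frontier_eq, interior_singleton, sdiff_empty,
    Metric.infEDist_singleton, edist_zero_right]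

end Pointwise

/-! ### Integrated estimates for the midpoint path -/

section Paths

variable {X : Type*} [NormedAddCommGroup X] [NormedSpace ℝ X]

theorem HasDerivAt.midpoint {γ₁ γ₂ : ℝ → X} {u v : X} {s : ℝ} (h₁ : HasDerivAt γ₁ u s)
    (h₂ : HasDerivAt γ₂ v s) :
    HasDerivAt (fun t => (2⁻¹ : ℝ) • (γ₁ t + γ₂ t)) ((2⁻¹ : ℝ) • (u + v)) s :=
  (h₁.fun_add h₂).fun_const_smul _

theorem LipschitzOnWith.midpoint {γ₁ γ₂ : ℝ → X} {S : Set ℝ} (h₁ : LipschitzOnWith 1 γ₁ S)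
    (h₂ : LipschitzOnWith 1 γ₂ S) :
    LipschitzOnWith (‖(2⁻¹ : ℝ)‖₊ * (1 + 1)) (fun t => (2⁻¹ : ℝ) • (γ₁ t + γ₂ t)) S :=
  (lipschitzWith_smul (2⁻¹ : ℝ)).comp_lipschitzOnWith (h₁.add h₂)

/-- The midpoint estimate on the interval on which both paths have unit speed. -/
theorem lintegral_midpoint_le [CompleteSpace X] [UniformConvexSpace X] {K C : ℝ} (hK0 : 0 ≤ K)
    (hC0 : 0 ≤ C)
    (hK : ∀ u v : X, ‖u‖ = 1 → ‖v‖ = 1 → K * ‖u - v‖ ^ 2 ≤ 1 - ‖u + v‖ / 2)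
    (hC : ∀ x y : X, 1 ≤ ‖(2⁻¹ : ℝ) • (x + y)‖ →
      (‖x‖ + ‖y‖) / 2 ≤ ‖(2⁻¹ : ℝ) • (x + y)‖ + C * ‖x - y‖ ^ 2)
    {T : ℝ} (hT : 0 ≤ T) (hCT : C * T ^ 2 ≤ K / 4) {γ₁ γ₂ : ℝ → X}
    (hγ₁ : HasUnitSpeedOn γ₁ (Icc 0 T)) (hγ₂ : HasUnitSpeedOn γ₂ (Icc 0 T)) (h0 : γ₁ 0 = γ₂ 0)
    (hn₁ : ∀ t ∈ Icc 0 T, 1 ≤ ‖γ₁ t‖ ∧ ‖γ₁ t‖ ≤ 2) (hn₂ : ∀ t ∈ Icc 0 T, 1 ≤ ‖γ₂ t‖ ∧ ‖γ₂ t‖ ≤ 2)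
    (hnm : ∀ t ∈ Icc 0 T, 1 ≤ ‖(2⁻¹ : ℝ) • (γ₁ t + γ₂ t)‖) :
    (∫⁻ s in Ioo 0 T, ‖deriv (fun t => (2⁻¹ : ℝ) • (γ₁ t + γ₂ t)) s‖ₑ *
        ‖(2⁻¹ : ℝ) • (γ₁ s + γ₂ s)‖ₑ⁻¹) +
      ∫⁻ s in Ioo 0 T, modulusOfConvexity X ‖deriv (fun t => γ₁ t - γ₂ t) s‖
        / ENNReal.ofReal (‖γ₁ s‖ + ‖γ₂ s‖) ≤
    ((∫⁻ s in Ioo 0 T, ‖γ₁ s‖ₑ⁻¹) + ∫⁻ s in Ioo 0 T, ‖γ₂ s‖ₑ⁻¹) / 2 := by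
  have hd₁ := hγ₁.ae_differentiableAt
  have hd₂ := hγ₂.ae_differentiableAt
  have hl₁ := hγ₁.lipschitzOnWith
  have hl₂ := hγ₂.lipschitzOnWith
  have hmeas : ∀ {f : ℝ → X}, ContinuousOn f (Icc 0 T) →
      AEMeasurable (fun t => ‖f t‖ₑ) (volume.restrict (Ioo 0 T)) := fun hf =>
    ((hf.mono Ioo_subset_Icc_self).enorm).aemeasurable measurableSet_Ioo
  have hm₁ := hmeas hl₁.continuousOn
  have hmm := hmeas (hl₁.midpoint hl₂).continuousOn
  have hmh := hmeas (hl₁.sub hl₂).continuousOn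
  have hpoinc := LipschitzOnWith.lintegral_enorm_sq_le (h := fun t => γ₁ t - γ₂ t) hT
    (hl₁.sub hl₂) (by simp [h0]) (by
      filter_upwards [hd₁, hd₂] with t h₁ h₂ using h₁.1.fun_sub h₂.1)
  have hmdm : Measurable fun s => ‖deriv (fun t => (2⁻¹ : ℝ) • (γ₁ t + γ₂ t)) s‖ₑ :=
    (stronglyMeasurable_deriv _).enorm
  have hmdh : Measurable fun s => ‖deriv (fun t => γ₁ t - γ₂ t) s‖ₑ :=
    (stronglyMeasurable_deriv _).enorm
  have hmprod : AEMeasurable (fun s => ‖deriv (fun t => (2⁻¹ : ℝ) • (γ₁ t + γ₂ t)) s‖ₑ *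
      ‖(2⁻¹ : ℝ) • (γ₁ s + γ₂ s)‖ₑ⁻¹) (volume.restrict (Ioo 0 T)) :=
    hmdm.aemeasurable.mul hmm.inv
  have hm₁' : AEMeasurable (fun s => ‖γ₁ s‖ₑ⁻¹) (volume.restrict (Ioo 0 T)) := hm₁.inv
  set J := ∫⁻ s in Ioo 0 T, ‖deriv (fun t => γ₁ t - γ₂ t) s‖ₑ ^ 2 with hJ
  have hae : ∀ᵐ s ∂volume.restrict (Ioo 0 T),
      ‖deriv (fun t => (2⁻¹ : ℝ) • (γ₁ t + γ₂ t)) s‖ₑ * ‖(2⁻¹ : ℝ) • (γ₁ s + γ₂ s)‖ₑ⁻¹ +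
        modulusOfConvexity X ‖deriv (fun t => γ₁ t - γ₂ t) s‖
          / ENNReal.ofReal (‖γ₁ s‖ + ‖γ₂ s‖) +
        ENNReal.ofReal (K / 4) * ‖deriv (fun t => γ₁ t - γ₂ t) s‖ₑ ^ 2 ≤
      (‖γ₁ s‖ₑ⁻¹ + ‖γ₂ s‖ₑ⁻¹) / 2 + ENNReal.ofReal C * ‖γ₁ s - γ₂ s‖ₑ ^ 2 := by
    filter_upwards [hd₁, hd₂, ae_restrict_mem measurableSet_Ioo] with s h₁ h₂ hmem
    have hs := Ioo_subset_Icc_self hmem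
    rw [(h₁.1.hasDerivAt.midpoint h₂.1.hasDerivAt).deriv,
      (h₁.1.hasDerivAt.fun_sub h₂.1.hasDerivAt).deriv]
    exact midpoint_speed_le hK0 hC0 hK hC (hn₁ s hs).1 (hn₁ s hs).2 (hn₂ s hs).1 (hn₂ s hs).2
      (hnm s hs) h₁.2 h₂.2
  have hint := lintegral_mono_ae hae
  -- Finiteness of the energy J is what permits cancelling (K/4) J from both sides in [0, ∞].
  have hJtop : J ≠ ⊤ := by
    have h4 : ∀ᵐ s ∂volume.restrict (Ioo 0 T),
        ‖deriv (fun t => γ₁ t - γ₂ t) s‖ₑ ^ 2 ≤ (2 : ℝ≥0∞) ^ 2 := by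
      filter_upwards [hd₁, hd₂] with s h₁ h₂
      rw [(h₁.1.hasDerivAt.fun_sub h₂.1.hasDerivAt).deriv]
      gcongr
      rw [← ofReal_norm, ← ENNReal.ofReal_ofNat]
      refine ENNReal.ofReal_le_ofReal ((norm_sub_le _ _).trans ?_)
      rw [h₁.2, h₂.2]
      norm_num
    refine ne_top_of_le_ne_top ?_ (lintegral_mono_ae h4)
    rw [lintegral_const, Measure.restrict_apply_univ, Real.volume_Ioo]
    exact ENNReal.mul_ne_top (by simp) ENNReal.ofReal_ne_top
  rw [lintegral_add_right _ ((hmdh.pow_const 2).const_mul _),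
    lintegral_add_left' hmprod, lintegral_const_mul _ (hmdh.pow_const 2),
    lintegral_add_right' _ ((hmh.pow_const 2).const_mul _),
    lintegral_const_mul'' _ (hmh.pow_const 2)] at hint
  have hhalf : ∫⁻ s in Ioo 0 T, (‖γ₁ s‖ₑ⁻¹ + ‖γ₂ s‖ₑ⁻¹) / 2 =
      ((∫⁻ s in Ioo 0 T, ‖γ₁ s‖ₑ⁻¹) + ∫⁻ s in Ioo 0 T, ‖γ₂ s‖ₑ⁻¹) / 2 := by
    simp_rw [div_eq_mul_inv]
    rw [lintegral_mul_const' _ _ (by simp), lintegral_add_left' hm₁']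
  rw [hhalf] at hint
  -- Poincaré and C T² ≤ K/4: the smoothness error is absorbed by the convexity surplus.
  have herr : ENNReal.ofReal C * ∫⁻ s in Ioo 0 T, ‖γ₁ s - γ₂ s‖ₑ ^ 2 ≤
      ENNReal.ofReal (K / 4) * J := by
    calc _ ≤ ENNReal.ofReal C * (ENNReal.ofReal T ^ 2 * J) := by gcongr
      _ = ENNReal.ofReal (C * T ^ 2) * J := by
        rw [ENNReal.ofReal_mul hC0, ENNReal.ofReal_pow hT, mul_assoc]
      _ ≤ _ := by gcongr
  exact ENNReal.le_of_add_le_add_right (ENNReal.mul_ne_top ENNReal.ofReal_ne_top hJtop)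
    (hint.trans (by gcongr))

/-- The contribution of the interval on which the first path does not move. -/
theorem lintegral_midpoint_tail_le [CompleteSpace X] [UniformConvexSpace X] {a b : ℝ} {p : X}
    {γ₁ γ₂ : ℝ → X} (hγ₁ : ∀ t ∈ Icc a b, γ₁ t = p) (hγ₂ : HasUnitSpeedOn γ₂ (Icc a b))
    (hn₂ : ∀ t ∈ Icc a b, ‖γ₂ t‖ ≤ 2)
    (hnm : ∀ t ∈ Icc a b, 1 ≤ ‖(2⁻¹ : ℝ) • (γ₁ t + γ₂ t)‖) :
    ∫⁻ s in Ioo a b, ‖deriv (fun t => (2⁻¹ : ℝ) • (γ₁ t + γ₂ t)) s‖ₑ *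
        ‖(2⁻¹ : ℝ) • (γ₁ s + γ₂ s)‖ₑ⁻¹ ≤ ∫⁻ s in Ioo a b, ‖γ₂ s‖ₑ⁻¹ := by
  refine lintegral_mono_ae ?_
  filter_upwards [hγ₂.ae_differentiableAt, ae_restrict_mem measurableSet_Ioo] with s h₂ hs
  have hs' := Ioo_subset_Icc_self hs
  have h₁ : HasDerivAt γ₁ 0 s := (hasDerivAt_const s p).congr_of_eventuallyEq <|
    EqOn.eventuallyEq_nhds_of_mem_Ioo (g := fun _ => p) hγ₁ hs
  rw [(h₁.midpoint h₂.1.hasDerivAt).deriv, zero_add]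
  have h3 : ‖(2⁻¹ : ℝ) • deriv γ₂ s‖ₑ = 2⁻¹ := by
    rw [← ofReal_norm, norm_smul, h₂.2, mul_one, norm_inv, Real.norm_two,
      ENNReal.ofReal_inv_of_pos two_pos, ENNReal.ofReal_ofNat]
  have h4 : (1 : ℝ≥0∞) ≤ ‖(2⁻¹ : ℝ) • (γ₁ s + γ₂ s)‖ₑ := by
    rw [← ofReal_norm, ENNReal.one_le_ofReal]
    exact hnm s hs'
  have h5 : ‖γ₂ s‖ₑ ≤ 2 := by
    rw [← ofReal_norm, ← ENNReal.ofReal_ofNat]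
    exact ENNReal.ofReal_le_ofReal (hn₂ s hs')
  calc _ ≤ (2⁻¹ : ℝ≥0∞) * 1 := by
        rw [h3]
        gcongr
        exact ENNReal.inv_le_one.2 h4
    _ ≤ ‖γ₂ s‖ₑ⁻¹ := by
        rw [mul_one]
        exact ENNReal.inv_le_inv.2 h5

end Paths

end Auxiliary

/-! ### The main inequality -/

theorem mainTheorem4 {X : Type*} [NormedAddCommGroup X] [NormedSpace ℝ X] [CompleteSpace X]
    (hconv : UniformlyConvexOfPowerType X 2) (hsmooth : UniformlySmoothOfPowerType X 2)
    (Ω : Set X) (hΩ : Ω = {(0 : X)}ᶜ) :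
    ∃ R : ℝ, 0 < R ∧ ∀ (t₁ t₂ : ℝ) (γ₁ γ₂ : ℝ → X), 0 ≤ t₁ → t₁ ≤ t₂ →
      ContinuousOn γ₁ (Icc 0 t₂) → ContinuousOn γ₂ (Icc 0 t₂) →
      -- the paths and their midpoint path lie in `B(0, 2) \ B(0, 1)`
      (∀ t ∈ Icc 0 t₂, γ₁ t ∈ Metric.ball (0 : X) 2 \ Metric.ball (0 : X) 1) →
      (∀ t ∈ Icc 0 t₂, γ₂ t ∈ Metric.ball (0 : X) 2 \ Metric.ball (0 : X) 1) →
      (∀ t ∈ Icc 0 t₂,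
        (2⁻¹ : ℝ) • (γ₁ t + γ₂ t) ∈ Metric.ball (0 : X) 2 \ Metric.ball (0 : X) 1) →
      γ₁ 0 = γ₂ 0 →
      quasihyperbolicLength Ω γ₁ 0 t₂ ≤ ENNReal.ofReal R →
      quasihyperbolicLength Ω γ₂ 0 t₂ ≤ ENNReal.ofReal R →
      -- the lengths are `t₁ ≤ t₂`, and the parametrisation is by arc length, up to the
      -- constant final piece of `γ₁`
      eVariationOn γ₁ (Icc 0 t₂) = ENNReal.ofReal t₁ →
      eVariationOn γ₂ (Icc 0 t₂) = ENNReal.ofReal t₂ →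
      HasUnitSpeedOn γ₁ (Icc 0 t₁) → (∀ t ∈ Icc t₁ t₂, γ₁ t = γ₁ t₁) →
      HasUnitSpeedOn γ₂ (Icc 0 t₂) →
      (∀ᵐ s ∂volume.restrict (Ioo 0 t₁), DifferentiableAt ℝ (fun t => γ₁ t - γ₂ t) s) ∧
      quasihyperbolicLength Ω (fun t => (2⁻¹ : ℝ) • (γ₁ t + γ₂ t)) 0 t₂
          + ∫⁻ s in Ioo 0 t₁, modulusOfConvexity X ‖deriv (fun t => γ₁ t - γ₂ t) s‖
              / ENNReal.ofReal (‖γ₁ s‖ + ‖γ₂ s‖)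
        ≤ (quasihyperbolicLength Ω γ₁ 0 t₂ + quasihyperbolicLength Ω γ₂ 0 t₂) / 2
          + arcLengthIntegral (fun z => (2 * bdryDist Ω z)⁻¹) γ₂ t₁ t₂ := by
  have := hconv.uniformConvexSpace
  obtain ⟨K, hK0, hK⟩ := hconv.exists_sq_le
  obtain ⟨C, hC0, hC⟩ := hsmooth.exists_midpoint_bound
  -- The interval has length at most 2R, so absorption needs C(2R)² ≤ K/4, that is R² ≤ K/(16C); the
  -- cap at 1 gives R² ≤ R.
  set R := min 1 (K / (16 * C)) with hRdef
  have hR0 : 0 < R := lt_min one_pos (by positivity)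
  have hCR : C * (2 * R) ^ 2 ≤ K / 4 := by
    have h1 : R ^ 2 ≤ K / (16 * C) := by
      calc R ^ 2 = R * R := sq R
        _ ≤ 1 * (K / (16 * C)) := by
          gcongr
          · exact min_le_left _ _
          · exact min_le_right _ _
        _ = _ := one_mul _
    calc C * (2 * R) ^ 2 = 4 * C * R ^ 2 := by ring
      _ ≤ 4 * C * (K / (16 * C)) := by gcongr
      _ = K / 4 := by field_simp; norm_num
  refine ⟨R, hR0, ?_⟩
  intro t₁ t₂ γ₁ γ₂ ht₁ ht₂ _ _ hn₁ hn₂ hnm h0 _ hq₂ hv₁ hv₂ hs₁ hconst hs₂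
  subst hΩ
  have h0t₂ : (0 : ℝ) ≤ t₂ := ht₁.trans ht₂
  have hnorm : ∀ {z : X}, z ∈ Metric.ball (0 : X) 2 \ Metric.ball (0 : X) 1 →
      1 ≤ ‖z‖ ∧ ‖z‖ ≤ 2 := fun hz =>
    ⟨not_lt.1 fun h => hz.2 (mem_ball_zero_iff.2 h), (mem_ball_zero_iff.1 hz.1).le⟩
  replace hn₁ := fun t ht => hnorm (hn₁ t ht)
  replace hn₂ := fun t ht => hnorm (hn₂ t ht)
  replace hnm := fun t ht => (hnorm (hnm t ht)).1
  have : Nontrivial X := ⟨γ₁ 0, 0, fun h => by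
    have := (hn₁ 0 (left_mem_Icc.2 h0t₂)).1
    rw [h, norm_zero] at this
    linarith⟩
  have hs₂' : ∀ {x y : ℝ}, 0 ≤ x → y ≤ t₂ → HasUnitSpeedOn γ₂ (Icc x y) := fun hx hy =>
    HasUnitSpeedOn.mono_Icc hs₂ hx hy
  have hsub : ∀ {t}, t ∈ Icc 0 t₁ → t ∈ Icc 0 t₂ := fun ht => Icc_subset_Icc_right ht₂ ht
  have hsub' : ∀ {t}, t ∈ Icc t₁ t₂ → t ∈ Icc 0 t₂ := fun ht => Icc_subset_Icc_left ht₁ ht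
  have hd₁ := hs₁.ae_differentiableAt
  have hd₂' := (hs₂' le_rfl ht₂).ae_differentiableAt
  refine ⟨?_, ?_⟩
  · filter_upwards [hd₁, hd₂'] with s h₁ h₂ using h₁.1.fun_sub h₂.1
  have hl₁ : LipschitzOnWith 1 γ₁ (Icc 0 t₂) := hs₁.lipschitzOnWith.of_eq_const_right ht₁ hconst
  have hq₁_eq : quasihyperbolicLength ({0}ᶜ : Set X) γ₁ 0 t₂ = ∫⁻ t in Icc 0 t₁, ‖γ₁ t‖ₑ⁻¹ := by
    rw [quasihyperbolicLength, arcLengthIntegral_eq_of_hasUnitSpeedOn ht₁ ht₂ hs₁ (by simpa)]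
    simp_rw [bdryDist_compl_singleton_zero]
  have hq₂_eq : quasihyperbolicLength ({0}ᶜ : Set X) γ₂ 0 t₂ = ∫⁻ t in Icc 0 t₂, ‖γ₂ t‖ₑ⁻¹ := by
    rw [quasihyperbolicLength, arcLengthIntegral_eq_of_hasUnitSpeedOn h0t₂ le_rfl hs₂ (by simpa)]
    simp_rw [bdryDist_compl_singleton_zero]
  have htail_eq : arcLengthIntegral (fun z => (2 * bdryDist ({0}ᶜ : Set X) z)⁻¹) γ₂ t₁ t₂ =
      (∫⁻ t in Ioo t₁ t₂, ‖γ₂ t‖ₑ⁻¹) / 2 := by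
    rw [arcLengthIntegral_eq_of_hasUnitSpeedOn ht₂ le_rfl (hs₂' ht₁ le_rfl)
      (hs₂.eVariationOn_Icc ht₁ ht₂ le_rfl), ← restrict_Ioo_eq_restrict_Icc, div_eq_mul_inv,
      ← lintegral_mul_const' _ _ (by simp)]
    refine lintegral_congr fun t => ?_
    rw [bdryDist_compl_singleton_zero, ENNReal.mul_inv (by simp) (by simp), mul_comm]
  have hdm : ∀ᵐ t ∂volume.restrict (Ioo 0 t₂),
      DifferentiableAt ℝ (fun t => (2⁻¹ : ℝ) • (γ₁ t + γ₂ t)) t := by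
    rw [restrict_Ioo_eq_add ht₁ ht₂, ae_add_measure_iff]
    constructor
    · filter_upwards [hd₁, hd₂'] with s h₁ h₂
        using (h₁.1.hasDerivAt.midpoint h₂.1.hasDerivAt).differentiableAt
    · filter_upwards [(hs₂' ht₁ le_rfl).ae_differentiableAt, ae_restrict_mem measurableSet_Ioo]
        with s h₂ hs
      have h₁ : HasDerivAt γ₁ 0 s := (hasDerivAt_const s (γ₁ t₁)).congr_of_eventuallyEq <|
        EqOn.eventuallyEq_nhds_of_mem_Ioo (g := fun _ => γ₁ t₁) hconst hs
      exact (h₁.midpoint h₂.1.hasDerivAt).differentiableAt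
  have hsplit : ∀ f : ℝ → ℝ≥0∞, ∫⁻ t in Ioo 0 t₂, f t =
      (∫⁻ t in Ioo 0 t₁, f t) + ∫⁻ t in Ioo t₁ t₂, f t := fun f => by
    rw [restrict_Ioo_eq_add ht₁ ht₂, lintegral_add_measure]
  have hqm : quasihyperbolicLength ({0}ᶜ : Set X) (fun t => (2⁻¹ : ℝ) • (γ₁ t + γ₂ t)) 0 t₂ ≤
      (∫⁻ s in Ioo 0 t₁, ‖deriv (fun t => (2⁻¹ : ℝ) • (γ₁ t + γ₂ t)) s‖ₑ *
        ‖(2⁻¹ : ℝ) • (γ₁ s + γ₂ s)‖ₑ⁻¹) +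
      ∫⁻ s in Ioo t₁ t₂, ‖γ₂ s‖ₑ⁻¹ := by
    have h1 := arcLengthIntegral_le_lintegral_deriv
      (fun z => (bdryDist ({0}ᶜ : Set X) z)⁻¹) h0t₂ (hl₁.midpoint hs₂.lipschitzOnWith) hdm
    simp_rw [bdryDist_compl_singleton_zero] at h1
    rw [hsplit] at h1
    simp_rw [quasihyperbolicLength, bdryDist_compl_singleton_zero]
    refine h1.trans ?_
    refine add_le_add le_rfl ?_
    exact lintegral_midpoint_tail_le hconst (hs₂' ht₁ le_rfl) (fun t ht => (hn₂ t (hsub' ht)).2)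
      fun t ht => hnm t (hsub' ht)
  have ht₂R : t₂ ≤ 2 * R :=
    le_two_mul_of_lintegral_inv_le hR0.le (fun t ht => (hn₂ t ht).2) (hq₂_eq ▸ hq₂)
  have hmain := lintegral_midpoint_le hK0.le hC0.le hK hC ht₁
    (le_trans (by gcongr; exact ht₂.trans ht₂R) hCR) hs₁ (hs₂' le_rfl ht₂) h0
    (fun t ht => hn₁ t (hsub ht)) (fun t ht => hn₂ t (hsub ht)) fun t ht => hnm t (hsub ht)
  rw [hq₁_eq, hq₂_eq, htail_eq, ← restrict_Ioo_eq_restrict_Icc, ← restrict_Ioo_eq_restrict_Icc,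
    hsplit]
  calc _ ≤ _ := add_le_add_left hqm _
    _ = _ := add_right_comm _ _ _
    _ ≤ _ := add_le_add_left hmain _
    _ = _ := by
      -- On [t₁, t₂] the mean of the lengths supplies only half of the integral of 1/‖γ₂‖; the extra
      -- term of the theorem is the other half.
      rw [← add_assoc, ENNReal.add_div (b := ∫⁻ t in Ioo t₁ t₂, ‖γ₂ t‖ₑ⁻¹), add_assoc _ (_ / 2),
        ENNReal.add_halves]
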